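/- Let $K,L,T$ be positive integers. A degree table in $\mathcal{A}(K,L,T)$ is a quadruple $(\alpha_{\mathrm p},\alpha_{\mathrm s},\beta_{\mathrm p},\beta_{\mathrm s})$ of vectors of non-negative integers of sizes $K,T,L,T$ such that, with the concatenations $\alpha=(\alpha_{\mathrm p}\mid\alpha_{\mathrm s})$ and $\beta=(\beta_{\mathrm p}\mid\beta_{\mathrm s})$ and with $\operatorname{Set}(c)$ denoting the set of entries of a vector $c$: the entries of $\alpha$ are pairwise distinct, the entries of $\beta$ are pairwise distinct, and every $n\in\operatorname{Set}(\alpha_{\mathrm p})+\operatorname{Set}(\beta_{\mathrm p})$ has exactly one representation $n=i+j$ with $i\in\operatorname{Set}(\alpha)$ and $j\in\operatorname{Set}(\beta)$. Put $N(\alpha,\beta)=|\operatorname{Set}(\alpha)+\operatorname{Set}(\beta)|$, and let $N(K,L,T)$ be the minimum of $N(\alpha,\beta)$ over $\mathcal{A}(K,L,T)$. A degree table is normal if each of the four vectors is sorted in increasing order, the smallest entry of $\alpha$ and the smallest entry of $\beta$ are both $0$, and the greatest common divisor of all entries of $\alpha$ and $\beta$ is $1$. Suppose that $2KL-K-L-\min\{K,L\}+3\le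 T$. Then every normal degree table $(\alpha^*,\beta^*)\in\mathcal{A}(K,L,T)$ with $N(\alpha^*,\beta^*)=N(K,L,T)$ has largest $\alpha^*$-entry at most $2KL+T-1-L$ and largest $\beta^*$-entry at most $2KL+T-1-K$. Consequently the determination of $N(K,L,T)$ is a finite search: there are only finitely many normal degree tables in $\mathcal{A}(K,L,T)$ whose $\alpha$-entries are at most $2KL+T-1-L$ and whose $\beta$-entries are at most $2KL+T-1-K$, and $N(K,L,T)$ is the minimum of $N(\alpha,\beta)$ over these tables. -/

import Mathlib

open scoped Pointwise

/-- A quadruple `(α_p, α_s, β_p, β_s)` of vectors of non-negative integers,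
of sizes `K`, `T`, `L`, `T` (prefixes `α_p`, `β_p` and suffixes `α_s`, `β_s`). -/
@[ext]
structure ExponentVectors (K L T : ℕ) where
  alphaP : Fin K → ℕ
  alphaS : Fin T → ℕ
  betaP : Fin L → ℕ
  betaS : Fin T → ℕ

namespace ExponentVectors

variable {K L T : ℕ}

/-- The concatenation `α = (α_p | α_s)`. -/
def alpha (D : ExponentVectors K L T) : Fin (K + T) → ℕ := Fin.append D.alphaP D.alphaS

/-- The concatenation `β = (β_p | β_s)`. -/
def beta (D : ExponentVectors K L T) : Fin (L + T) → ℕ := Fin.append D.betaP D.betaS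

/-- The set of entries of `α`. -/
def alphaSet (D : ExponentVectors K L T) : Finset ℕ := Finset.univ.image D.alpha

/-- The set of entries of `β`. -/
def betaSet (D : ExponentVectors K L T) : Finset ℕ := Finset.univ.image D.beta

/-- The set of entries of `α_p`. -/
def alphaPSet (D : ExponentVectors K L T) : Finset ℕ := Finset.univ.image D.alphaP

/-- The set of entries of `β_p`. -/
def betaPSet (D : ExponentVectors K L T) : Finset ℕ := Finset.univ.image D.betaP

/-- The quadruple is a degree table. -/
structure IsDegreeTable (D : ExponentVectors K L T) : Prop where
  /-- all integers in `α` are distinct -/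
  alpha_injective : Function.Injective D.alpha
  /-- all integers in `β` are distinct -/
  beta_injective : Function.Injective D.beta
  /-- every entry of the upper left block is represented only once as a sum of an entry of `α`
  and an entry of `β` -/
  decodable : ∀ n ∈ D.alphaPSet + D.betaPSet,
    ∃! p : ℕ × ℕ, p.1 ∈ D.alphaSet ∧ p.2 ∈ D.betaSet ∧ n = p.1 + p.2

/-- `N(α, β)`: the cardinality of the sumset `Set(α) + Set(β)`. -/
def numTerms (D : ExponentVectors K L T) : ℕ := (D.alphaSet + D.betaSet).card

/-- The table is normal: the four vectors are increasing, the smallest entry of `α` and the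
smallest entry of `β` are zero, and the greatest common divisor of all entries is one. -/
structure IsNormal (D : ExponentVectors K L T) : Prop where
  alphaP_sorted : StrictMono D.alphaP
  alphaS_sorted : StrictMono D.alphaS
  betaP_sorted : StrictMono D.betaP
  betaS_sorted : StrictMono D.betaS
  alpha_min : IsLeast (D.alphaSet : Set ℕ) 0
  beta_min : IsLeast (D.betaSet : Set ℕ) 0
  gcd_eq_one : (D.alphaSet ∪ D.betaSet).gcd id = 1

end ExponentVectors

/-- `𝒜(K, L, T)`: the set of all degree tables of sizes `K`, `T`, `L`, `T`. -/
def degreeTables (K L T : ℕ) : Set (ExponentVectors K L T) := {D | D.IsDegreeTable}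

/-- `N(K, L, T)`: the minimum of `N(α, β)` over all degree tables. -/
noncomputable def minNumTerms (K L T : ℕ) : ℕ :=
  sInf (ExponentVectors.numTerms '' degreeTables K L T)

/-- The normal degree tables whose `α`-entries are at most `a` and whose `β`-entries are at
most `b`. -/
def boundedNormalTables (K L T : ℕ) (a b : ℤ) : Set (ExponentVectors K L T) :=
  {D | D ∈ degreeTables K L T ∧ D.IsNormal ∧
    (∀ i, (D.alpha i : ℤ) ≤ a) ∧ (∀ j, (D.beta j : ℤ) ≤ b)}

/-! An optimal table has a sumset so small that its two sets must be short. The explicit table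
`gaspBig` shows N(K,L,T) ≤ 2KL + 2T - 1. Write A and B for the entry sets of an optimal normal
table, so |A| = K + T and |B| = L + T. The hypothesis on T then says exactly that this bound is at
most |A| + |B| + min(|A|,|B|) - 4. Under such a bound the Lev-Smeliansky theorem (`max_add_card_le`)
gives max A ≤ |A+B| - |B| and max B ≤ |A+B| - |A|, which are the claimed bounds. Since every table
can be normalized without changing N, the search over bounded tables is complete.

For Lev-Smeliansky, let a be the larger of the two maxima and reduce modulo a. If A + B covers all
residues, then adding 0 and a to B gains one element in every class, so |A+B| ≥ a + |B|. If not,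
Kneser's theorem in `ZMod a` makes the reduced sumset a union of cosets of a subgroup H, and
counting lifts coset by coset contradicts the smallness of A + B (`mem_add_image_cast`). -/

/-! ### Kneser's theorem in finite abelian groups -/

section Kneser

variable {G : Type*} [AddCommGroup G]

/-- `C` is a union of cosets of `H`. -/
def IsPeriodic (H : AddSubgroup G) (C : Finset G) : Prop :=
  ∀ x ∈ C, ∀ h ∈ H, x + h ∈ C

lemma IsPeriodic.add_mem_iff {H : AddSubgroup G} {C : Finset G} (hC : IsPeriodic H C) {x h : G}
    (hh : h ∈ H) : x + h ∈ C ↔ x ∈ C :=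
  ⟨fun hx => by simpa using hC _ hx _ (H.neg_mem hh), fun hx => hC _ hx _ hh⟩

/-- A nonempty set that is periodic has at least as many elements as its period. -/
lemma IsPeriodic.card_le [Finite G] {H : AddSubgroup G} {C : Finset G} (hC : IsPeriodic H C)
    (hne : C.Nonempty) : Nat.card H ≤ C.card := by
  obtain ⟨x, hx⟩ := hne
  rw [← Nat.card_eq_finsetCard]
  exact Nat.card_le_card_of_injective (fun h : H => (⟨x + h, hC x hx h h.2⟩ : C))
    fun a b hab => by simpa using hab

/-- The coset `x + H` as a finset. -/
noncomputable def cosetFinset [Finite G] (H : AddSubgroup G) (x : G) : Finset G :=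
  (Set.toFinite {y | y - x ∈ H}).toFinset

@[simp] lemma mem_cosetFinset [Finite G] {H : AddSubgroup G} {x y : G} :
    y ∈ cosetFinset H x ↔ y - x ∈ H := by simp [cosetFinset]

lemma card_cosetFinset [Finite G] (H : AddSubgroup G) (x : G) :
    (cosetFinset H x).card = Nat.card H := by
  rw [← Nat.card_eq_finsetCard]
  exact Nat.card_congr ⟨fun y => ⟨y.1 - x, mem_cosetFinset.1 y.2⟩,
    fun h => ⟨h.1 + x, by simp⟩, fun y => by simp, fun h => by simp⟩

variable [DecidableEq G]

lemma IsPeriodic.union {H₁ H₂ : AddSubgroup G} {C₁ C₂ : Finset G} (h₁ : IsPeriodic H₁ C₁)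
    (h₂ : IsPeriodic H₂ C₂) : IsPeriodic (H₁ ⊓ H₂) (C₁ ∪ C₂) := by
  intro x hx h hh
  rw [AddSubgroup.mem_inf] at hh
  rw [Finset.mem_union] at hx ⊢
  exact hx.imp (fun hx => h₁ x hx h hh.1) (fun hx => h₂ x hx h hh.2)

/-- The Dyson transform argument: between `A` and `A + B` there is a large periodic set. -/
lemma exists_isPeriodic_between [Finite G] (A B : Finset G) (hA : A.Nonempty) (h0 : (0 : G) ∈ B) :
    ∃ (C : Finset G) (H : AddSubgroup G), A ⊆ C ∧ C ⊆ A + B ∧ IsPeriodic H C ∧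
      A.card + B.card ≤ C.card + Nat.card H := by
  induction hn : B.card using Nat.strong_induction_on generalizing A B with
  | _ n ih =>
  subst hn
  by_cases hAB : ∀ e ∈ A, ∀ b ∈ B, e + b ∈ A
  · refine ⟨A, AddSubgroup.closure (B : Set G), subset_rfl, ?_, ?_, ?_⟩
    · exact fun x hx => Finset.mem_add.2 ⟨x, hx, 0, h0, add_zero x⟩
    · intro x hx h hh
      have key : ∀ b ∈ B, ∀ y, y + b ∈ A ↔ y ∈ A := by
        intro b hb y
        -- Translation by b maps the finite set A injectively into itself, hence onto itself. So A
        -- is also stable under -b, and under the whole group generated by B.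
        have himg : A.image (· + b) = A := by
          refine Finset.eq_of_subset_of_card_le ?_ ?_
          · intro z hz
            obtain ⟨e, he, rfl⟩ := Finset.mem_image.1 hz
            exact hAB e he b hb
          · rw [Finset.card_image_of_injective _ (add_left_injective b)]
        constructor
        · intro hy
          rw [← himg] at hy
          obtain ⟨e, he, h⟩ := Finset.mem_image.1 hy
          exact add_right_cancel h ▸ he
        · exact fun hy => hAB y hy b hb
      have : ∀ y, y + h ∈ A ↔ y ∈ A := by
        induction hh using AddSubgroup.closure_induction with
        | mem b hb => exact key b hb
        | zero => simp
        | add p q _ _ hp hq => intro y; rw [← add_assoc, hq, hp]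
        | neg p _ hp => intro y; rw [← hp (y + -p)]; simp
      exact (this x).2 hx
    · gcongr
      exact (Nat.card_eq_finsetCard B).symm.trans_le
        (Nat.card_mono (Set.toFinite _) AddSubgroup.subset_closure)
  · push Not at hAB
    obtain ⟨e, he, b, hb, heb⟩ := hAB
    -- Passing to A ∪ (e + B) and B ∩ (A - e) keeps the total size and does not enlarge the sumset.
    -- The second set loses b, because e + b ∉ A, and keeps 0, because e ∈ A.
    have hcard := Finset.addDysonETransform.card e (A, B)
    have hsub := Finset.addDysonETransform.subset (e := e) (x := (A, B))
    simp only [Finset.addDysonETransform] at hcard hsub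
    have hlt : (B ∩ (-e +ᵥ A)).card < B.card := by
      refine Finset.card_lt_card ⟨Finset.inter_subset_left, fun h => heb ?_⟩
      have := (Finset.mem_inter.1 (h hb)).2
      rw [Finset.mem_vadd_finset] at this
      obtain ⟨z, hz, rfl⟩ := this
      simpa using hz
    have h0' : (0 : G) ∈ B ∩ (-e +ᵥ A) := by
      refine Finset.mem_inter.2 ⟨h0, Finset.mem_vadd_finset.2 ⟨e, he, by simp⟩⟩
    obtain ⟨C, H, h1, h2, h3, h4⟩ := ih _ hlt (A ∪ (e +ᵥ B)) _ (hA.mono Finset.subset_union_left)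
      h0' rfl
    exact ⟨C, H, Finset.subset_union_left.trans h1, h2.trans hsub, h3, by omega⟩

/-- Translating B by -b puts 0 into it, so the previous lemma applies; its C contains a, and
translating back by b captures n = a + b. -/
lemma exists_isPeriodic_mem [Finite G] (A B : Finset G) {n : G} (hn : n ∈ A + B) :
    ∃ (C : Finset G) (H : AddSubgroup G), n ∈ C ∧ C ⊆ A + B ∧ IsPeriodic H C ∧
      A.card + B.card ≤ C.card + Nat.card H := by
  obtain ⟨a, ha, b, hb, rfl⟩ := Finset.mem_add.1 hn
  obtain ⟨C, H, h1, h2, h3, h4⟩ := exists_isPeriodic_between A (B.image (· - b)) ⟨a, ha⟩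
    (Finset.mem_image.2 ⟨b, hb, sub_self b⟩)
  rw [Finset.card_image_of_injective _ (sub_left_injective)] at h4
  refine ⟨C.image (· + b), H, Finset.mem_image_of_mem _ (h1 ha), ?_, ?_, ?_⟩
  · intro x hx
    obtain ⟨c, hc, rfl⟩ := Finset.mem_image.1 hx
    obtain ⟨p, hp, q, hq, rfl⟩ := Finset.mem_add.1 (h2 hc)
    obtain ⟨r, hr, rfl⟩ := Finset.mem_image.1 hq
    exact Finset.mem_add.2 ⟨p, hp, r, hr, by abel⟩
  · intro x hx h hh
    obtain ⟨c, hc, rfl⟩ := Finset.mem_image.1 hx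
    exact Finset.mem_image.2 ⟨c + h, h3 c hc h hh, by abel⟩
  · rwa [Finset.card_image_of_injective _ (add_left_injective b)]

/-- If `P` and `Q` lie in the cosets `x + H₁` and `x + H₂`, then `P + Q` covers each of its
points at most `|H₁ ∩ H₂|` times. -/
lemma card_mul_card_le_of_cosets [Finite G] (H₁ H₂ : AddSubgroup G) (P Q X : Finset G) (x : G)
    (hP : ∀ p ∈ P, p - x ∈ H₁) (hQ : ∀ q ∈ Q, q - x ∈ H₂)
    (hX : ∀ p ∈ P, ∀ q ∈ Q, p + q - x ∈ X) :
    P.card * Q.card ≤ X.card * Nat.card (H₁ ⊓ H₂ : AddSubgroup G) := by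
  classical
  rw [← Finset.card_product, mul_comm]
  refine Finset.card_le_mul_card_image_of_maps_to (f := fun z => z.1 + z.2 - x) ?_ _ ?_
  · rintro ⟨p, q⟩ h
    rw [Finset.mem_product] at h
    exact hX p h.1 q h.2
  · intro y _
    rcases Finset.eq_empty_or_nonempty ((P ×ˢ Q).filter fun z => z.1 + z.2 - x = y) with he | ⟨z, hz⟩
    · simp [he]
    · rw [Finset.mem_filter, Finset.mem_product] at hz
      rw [← Nat.card_eq_finsetCard]
      refine Nat.card_le_card_of_injective
        (fun w => (⟨w.1.1 - z.1, ?_⟩ : (H₁ ⊓ H₂ : AddSubgroup G))) ?_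
      · have hw := w.2
        rw [Finset.mem_filter, Finset.mem_product] at hw
        refine AddSubgroup.mem_inf.2 ⟨?_, ?_⟩
        · simpa using H₁.sub_mem (hP _ hw.1.1) (hP _ hz.1.1)
        · have h1 := H₂.sub_mem (hQ _ hz.1.2) (hQ _ hw.1.2)
          have h2 : z.1 + z.2 = w.1.1 + w.1.2 := sub_left_injective (hz.2.trans hw.2.symm)
          have : z.2 - x - (w.1.2 - x) = w.1.1 - z.1 := by
            rw [sub_sub_sub_cancel_right, sub_eq_sub_iff_add_eq_add, add_comm z.2, h2]
          rwa [this] at h1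
      · rintro ⟨w, hw⟩ ⟨w', hw'⟩ h
        rw [Finset.mem_filter, Finset.mem_product] at hw hw'
        have h1 : w.1 = w'.1 := by simpa using h
        have h2 : w.1 + w.2 = w'.1 + w'.2 := sub_left_injective (hw.2.trans hw'.2.symm)
        rw [h1] at h2
        exact Subtype.ext (Prod.ext h1 (add_left_cancel h2))

/-- Fix x in C₁ \ C₂; then x + H₁ lies in C₁ and x + H₂ misses C₂. Split x + H₁ by C₂ into p points
outside and r inside, and x + H₂ by C₁ into q inside and s outside. With h = |H₁ ∩ H₂|, adding
points of these pieces gives pq ≤ h|C₁ \ C₂| and rs ≤ h|C₂ \ C₁|. Each piece is a union of cosets of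
H₁ ∩ H₂, so it is empty or has at least h points. -/
lemma card_sdiff_of_isPeriodic [Finite G] {H₁ H₂ : AddSubgroup G} {C₁ C₂ : Finset G}
    (h₁ : IsPeriodic H₁ C₁) (h₂ : IsPeriodic H₂ C₂) (hne : (C₁ \ C₂).Nonempty) :
    Nat.card H₂ ≤ (C₁ \ C₂).card + Nat.card (H₁ ⊓ H₂ : AddSubgroup G) ∨
    Nat.card H₁ ≤ (C₂ \ C₁).card + Nat.card (H₁ ⊓ H₂ : AddSubgroup G) ∨
    Nat.card H₁ ≤ (C₁ \ C₂).card := by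
  obtain ⟨x, hx⟩ := hne
  rw [Finset.mem_sdiff] at hx
  set H₀ := H₁ ⊓ H₂
  have hH₀ : ∀ {h}, h ∈ H₀ → h ∈ H₁ ∧ h ∈ H₂ := fun h => AddSubgroup.mem_inf.1 h
  have mem₁ : ∀ {y z}, y - z ∈ H₁ → (y ∈ C₁ ↔ z ∈ C₁) := fun {y z} h => by
    simpa using h₁.add_mem_iff (x := z) h
  have mem₂ : ∀ {y z}, y - z ∈ H₂ → (y ∈ C₂ ↔ z ∈ C₂) := fun {y z} h => by
    simpa using h₂.add_mem_iff (x := z) h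
  have per : ∀ (H : AddSubgroup G), H₀ ≤ H → IsPeriodic H₀ (cosetFinset H x) := by
    intro H hle y hy h hh
    rw [mem_cosetFinset] at hy ⊢
    rw [add_sub_right_comm]
    exact H.add_mem hy (hle hh)
  have per₁ : IsPeriodic H₀ C₁ := fun y hy h hh => h₁ y hy h (hH₀ hh).1
  have per₂ : IsPeriodic H₀ C₂ := fun y hy h hh => h₂ y hy h (hH₀ hh).2
  have perInter : ∀ {C D : Finset G}, IsPeriodic H₀ C → IsPeriodic H₀ D → IsPeriodic H₀ (C ∩ D) :=
    fun hC hD y hy h hh => Finset.mem_inter.2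
      ⟨hC y (Finset.mem_inter.1 hy).1 h hh, hD y (Finset.mem_inter.1 hy).2 h hh⟩
  have perSdiff : ∀ {C D : Finset G}, IsPeriodic H₀ C → IsPeriodic H₀ D → IsPeriodic H₀ (C \ D) :=
    fun hC hD y hy h hh => Finset.mem_sdiff.2
      ⟨hC y (Finset.mem_sdiff.1 hy).1 h hh, by
        rw [hD.add_mem_iff hh]; exact (Finset.mem_sdiff.1 hy).2⟩
  have hX := card_mul_card_le_of_cosets H₁ H₂ (cosetFinset H₁ x \ C₂) (cosetFinset H₂ x ∩ C₁)
    (C₁ \ C₂) x (fun p hp => by simpa using (Finset.mem_sdiff.1 hp).1)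
    (fun p hp => by simpa using (Finset.mem_inter.1 hp).1) (by
      intro p hp q hq
      rw [Finset.mem_sdiff, mem_cosetFinset] at hp
      rw [Finset.mem_inter, mem_cosetFinset] at hq
      rw [Finset.mem_sdiff]
      refine ⟨(mem₁ (z := q) ?_).2 hq.2, fun h => hp.2 ((mem₂ (z := p) ?_).1 h)⟩
      · rw [show p + q - x - q = p - x by abel]; exact hp.1
      · rw [show p + q - x - p = q - x by abel]; exact hq.1)
  have hY := card_mul_card_le_of_cosets H₁ H₂ (cosetFinset H₁ x ∩ C₂) (cosetFinset H₂ x \ C₁)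
    (C₂ \ C₁) x (fun p hp => by simpa using (Finset.mem_inter.1 hp).1)
    (fun p hp => by simpa using (Finset.mem_sdiff.1 hp).1) (by
      intro p hp q hq
      rw [Finset.mem_inter, mem_cosetFinset] at hp
      rw [Finset.mem_sdiff, mem_cosetFinset] at hq
      rw [Finset.mem_sdiff]
      refine ⟨(mem₂ (z := p) ?_).2 hp.2, fun h => hq.2 ((mem₁ (z := q) ?_).1 h)⟩
      · rw [show p + q - x - p = q - x by abel]; exact hq.1
      · rw [show p + q - x - q = p - x by abel]; exact hp.1)
  have e₁ := Finset.card_inter_add_card_sdiff (cosetFinset H₁ x) C₂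
  have e₂ := Finset.card_inter_add_card_sdiff (cosetFinset H₂ x) C₁
  rw [card_cosetFinset] at e₁ e₂
  have b₁ : Nat.card H₀ ≤ (cosetFinset H₁ x \ C₂).card :=
    (perSdiff (per H₁ inf_le_left) per₂).card_le ⟨x, by simpa using hx.2⟩
  have b₂ : Nat.card H₀ ≤ (cosetFinset H₂ x ∩ C₁).card :=
    (perInter (per H₂ inf_le_right) per₁).card_le ⟨x, by simpa using hx.1⟩
  have b₃ := fun hne => (perInter (per H₁ inf_le_left) per₂).card_le hne
  have b₄ := fun hne => (perSdiff (per H₂ inf_le_right) per₁).card_le hne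
  rw [← Finset.card_pos] at b₃ b₄
  have hpos : 0 < Nat.card H₀ := Nat.card_pos
  change _ ≤ _ * Nat.card H₀ at hX hY
  generalize (cosetFinset H₁ x \ C₂).card = p at *
  generalize (cosetFinset H₂ x ∩ C₁).card = q at *
  generalize (cosetFinset H₁ x ∩ C₂).card = r at *
  generalize (cosetFinset H₂ x \ C₁).card = s at *
  generalize (C₁ \ C₂).card = X at *
  generalize (C₂ \ C₁).card = Y at *
  generalize Nat.card H₀ = h at *
  rw [← e₁, ← e₂]
  rcases Nat.eq_zero_or_pos r with hr | hr
  · right; right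
    have : p * h ≤ X * h := (Nat.mul_le_mul_left p b₂).trans hX
    have := Nat.le_of_mul_le_mul_right this hpos
    omega
  rcases Nat.eq_zero_or_pos s with hs | hs
  · left
    have : q * h ≤ X * h := by nlinarith
    have := Nat.le_of_mul_le_mul_right this hpos
    omega
  -- From (p - h)(q - h) ≥ 0, and likewise for r and s. Adding the two bounds gives |H₁| + |H₂| ≤ X
  -- + Y + 2h.
  have hX' : p + q ≤ X + h := by
    have : (p + q) * h ≤ (X + h) * h := by nlinarith
    exact Nat.le_of_mul_le_mul_right this hpos
  have hY' : r + s ≤ Y + h := by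
    have h3 := b₃ hr
    have h4 := b₄ hs
    have : (r + s) * h ≤ (Y + h) * h := by nlinarith
    exact Nat.le_of_mul_le_mul_right this hpos
  omega

/-- Lets a union replace one of its two parts without lowering size plus period. The previous lemma
is used in both orders; the one case left, |H₁| ≤ |C₁ \ C₂| and |H₂| ≤ |C₂ \ C₁|, is settled by
comparing |H₁| with |H₂|. -/
lemma card_add_card_union_of_isPeriodic [Finite G] {H₁ H₂ : AddSubgroup G} {C₁ C₂ : Finset G}
    (h₁ : IsPeriodic H₁ C₁) (h₂ : IsPeriodic H₂ C₂) (hne₁ : (C₁ \ C₂).Nonempty)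
    (hne₂ : (C₂ \ C₁).Nonempty) :
    C₁.card + Nat.card H₁ ≤ (C₁ ∪ C₂).card + Nat.card (H₁ ⊓ H₂ : AddSubgroup G) ∨
    C₂.card + Nat.card H₂ ≤ (C₁ ∪ C₂).card + Nat.card (H₁ ⊓ H₂ : AddSubgroup G) := by
  have k₁ := card_sdiff_of_isPeriodic h₁ h₂ hne₁
  have k₂ := card_sdiff_of_isPeriodic h₂ h₁ hne₂
  rw [inf_comm H₂ H₁] at k₂
  have e₁ := Finset.card_sdiff_add_card C₁ C₂
  have e₂ := Finset.card_sdiff_add_card C₂ C₁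
  rw [Finset.union_comm] at e₂
  omega

/-- A weak form of **Kneser's theorem**. -/
lemma exists_isPeriodic_add [Finite G] (A B : Finset G) (hA : A.Nonempty) (hB : B.Nonempty) :
    ∃ H : AddSubgroup G, IsPeriodic H (A + B) ∧
      A.card + B.card ≤ (A + B).card + Nat.card H := by
  classical
  let S := (A + B).powerset.filter fun C => ∃ H : AddSubgroup G, IsPeriodic H C ∧
    A.card + B.card ≤ C.card + Nat.card H
  have hS : S.Nonempty := by
    obtain ⟨n, hn⟩ := hA.add hB
    obtain ⟨C, H, -, h2, h3, h4⟩ := exists_isPeriodic_mem A B hn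
    exact ⟨C, Finset.mem_filter.2 ⟨Finset.mem_powerset.2 h2, H, h3, h4⟩⟩
  -- A largest such C is all of A + B: if it missed n, a periodic D through n, or C ∪ D, would be
  -- larger and still admissible.
  obtain ⟨C, hC, hmax⟩ := S.exists_max_image Finset.card hS
  obtain ⟨hCs, H, hH, hcard⟩ := Finset.mem_filter.1 hC
  rw [Finset.mem_powerset] at hCs
  by_cases hsub : A + B ⊆ C
  · obtain rfl := hCs.antisymm hsub
    exact ⟨H, hH, hcard⟩
  obtain ⟨n, hn, hnC⟩ := Finset.not_subset.1 hsub
  obtain ⟨D, H', h1, h2, h3, h4⟩ := exists_isPeriodic_mem A B hn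
  by_cases hCD : C ⊆ D
  · have := hmax D (Finset.mem_filter.2 ⟨Finset.mem_powerset.2 h2, H', h3, h4⟩)
    have hlt := Finset.card_lt_card ⟨hCD, fun h => hnC (h h1)⟩
    omega
  · have hun := card_add_card_union_of_isPeriodic hH h3
      (Finset.sdiff_nonempty.2 hCD) ⟨n, Finset.mem_sdiff.2 ⟨h1, hnC⟩⟩
    have := hmax (C ∪ D) (Finset.mem_filter.2
      ⟨Finset.mem_powerset.2 (Finset.union_subset hCs h2), H ⊓ H', hH.union h3, by omega⟩)
    have hlt : C.card < (C ∪ D).card :=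
      Finset.card_lt_card ⟨Finset.subset_union_left, fun h => hnC (h (Finset.mem_union_right _ h1))⟩
    omega

/-- **Kneser's theorem** for finite abelian groups. -/
theorem kneser [Finite G] (A B : Finset G) (hA : A.Nonempty) (hB : B.Nonempty) :
    ∃ H : AddSubgroup G, IsPeriodic H (A + B) ∧
      (A + cosetFinset H 0).card + (B + cosetFinset H 0).card ≤ (A + B).card + Nat.card H := by
  -- The full stabilizer of A + B. Fattening A and B by H leaves their sum unchanged, so the weak
  -- form applies to the fattened sets, and the period it yields lies in H.
  let H : AddSubgroup G :=
    { carrier := {h | ∀ x, x + h ∈ A + B ↔ x ∈ A + B}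
      zero_mem' := by simp
      add_mem' := fun {p q} hp hq x => by
        rw [← add_assoc, hq, hp]
      neg_mem' := fun {p} hp x => by
        rw [← hp (x + -p), neg_add_cancel_right] }
  have hH : IsPeriodic H (A + B) := fun x hx h hh => (hh x).2 hx
  have hadd : (A + cosetFinset H 0) + (B + cosetFinset H 0) = A + B := by
    ext z
    constructor
    · intro hz
      obtain ⟨_, h1, _, h2, rfl⟩ := Finset.mem_add.1 hz
      obtain ⟨a, ha, h, hh, rfl⟩ := Finset.mem_add.1 h1
      obtain ⟨b, hb, k, hk, rfl⟩ := Finset.mem_add.1 h2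
      rw [mem_cosetFinset, sub_zero] at hh hk
      rw [add_add_add_comm]
      exact hH _ (Finset.add_mem_add ha hb) _ (H.add_mem hh hk)
    · have h0 : (0 : G) ∈ cosetFinset H 0 := by simp
      intro hz
      obtain ⟨a, ha, b, hb, rfl⟩ := Finset.mem_add.1 hz
      exact Finset.add_mem_add (by simpa using Finset.add_mem_add ha h0)
        (by simpa using Finset.add_mem_add hb h0)
  have hne : (cosetFinset H 0).Nonempty := ⟨0, by simp⟩
  obtain ⟨H', h1, h2⟩ := exists_isPeriodic_add _ _ (hA.add hne) (hB.add hne)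
  rw [hadd] at h1 h2
  refine ⟨H, hH, h2.trans ?_⟩
  gcongr
  exact Nat.card_mono (Set.toFinite _) fun h hh x => h1.add_mem_iff hh

end Kneser

/-! ### The Lev-Smeliansky theorem -/

section SumsetsOfNaturals

/-- If `X` contains `0` and `m`, every residue class in `S` that meets `X + Y` contains more
elements of `X + Y` than of `Y`. -/
lemma card_add_card_le_card_filter (m : ℕ) (hm : 0 < m) (X Y : Finset ℕ) (h0 : 0 ∈ X) (hmX : m ∈ X)
    (S : Finset (ZMod m)) (hY : ∀ y ∈ Y, (y : ZMod m) ∈ S)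
    (hS : ∀ s ∈ S, ∃ n ∈ X + Y, (n : ZMod m) = s) :
    S.card + Y.card ≤ ((X + Y).filter fun n : ℕ => (n : ZMod m) ∈ S).card := by
  rw [Finset.card_eq_sum_card_fiberwise (f := fun n : ℕ => (n : ZMod m)) (t := S) (s := Y) hY,
    Finset.card_eq_sum_card_fiberwise (f := fun n : ℕ => (n : ZMod m)) (t := S)
      (s := (X + Y).filter fun n : ℕ => (n : ZMod m) ∈ S) (fun x hx => (Finset.mem_filter.1 hx).2),
    Finset.card_eq_sum_ones, ← Finset.sum_add_distrib]
  refine Finset.sum_le_sum fun s hs => ?_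
  rcases Finset.eq_empty_or_nonempty (Y.filter fun n : ℕ => (n : ZMod m) = s) with he | hne
  · obtain ⟨n, hn, rfl⟩ := hS s hs
    rw [he, Finset.card_empty, add_zero, Nat.one_le_iff_ne_zero, ← Nat.pos_iff_ne_zero,
      Finset.card_pos]
    exact ⟨n, by simp [hn, hs]⟩
  -- Adding {0, m} to the part of Y in one class stays in that class and gains at least one element.
  · have hcd := cauchy_davenport_add_of_linearOrder_isCancelAdd
      (s := ({0, m} : Finset ℕ)) (t := Y.filter fun n : ℕ => (n : ZMod m) = s) (by simp) hne
    rw [Finset.card_pair hm.ne] at hcd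
    have hle : ({0, m} + Y.filter fun n : ℕ => (n : ZMod m) = s).card ≤
        (((X + Y).filter fun n : ℕ => (n : ZMod m) ∈ S).filter fun n : ℕ => (n : ZMod m) = s).card := by
      refine Finset.card_le_card fun z hz => ?_
      obtain ⟨p, hp, q, hq, rfl⟩ := Finset.mem_add.1 hz
      rw [Finset.mem_filter] at hq
      have hpX : p ∈ X ∧ (p : ZMod m) = 0 := by
        rw [Finset.mem_insert, Finset.mem_singleton] at hp
        rcases hp with rfl | rfl
        · exact ⟨h0, by simp⟩
        · exact ⟨hmX, by simp⟩
      have : ((p + q : ℕ) : ZMod m) = s := by rw [Nat.cast_add, hpX.2, hq.2, zero_add]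
      rw [Finset.mem_filter, Finset.mem_filter, this]
      exact ⟨⟨Finset.add_mem_add hpX.1 hq.1, hs⟩, rfl⟩
    omega

/-- Two subsets of a finite abelian group with more elements than the group together have the
whole group as their sum. -/
lemma mem_add_of_card_lt {G : Type*} [AddCommGroup G] [DecidableEq G] [Fintype G] (P Q : Finset G)
    (h : Fintype.card G < P.card + Q.card) (g : G) : g ∈ P + Q := by
  by_contra hg
  have hd : Disjoint P (Q.image (g - ·)) := by
    rw [Finset.disjoint_left]
    intro x hx hx'
    obtain ⟨q, hq, rfl⟩ := Finset.mem_image.1 hx'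
    exact hg (Finset.mem_add.2 ⟨_, hx, q, hq, by simp⟩)
  have := Finset.card_le_univ (P ∪ Q.image (g - ·))
  rw [Finset.card_union_of_disjoint hd, Finset.card_image_of_injective _ sub_right_injective] at this
  omega

lemma card_le_card_image_cast (m : ℕ) (A : Finset ℕ) :
    (A.filter (· < m)).card ≤ (A.image fun n : ℕ => (n : ZMod m)).card := by
  rw [← Finset.card_image_of_injOn (s := A.filter (· < m)) (f := fun n : ℕ => (n : ZMod m))]
  · exact Finset.card_le_card (Finset.image_subset_image (Finset.filter_subset _ _))
  · intro x hx y hy hxy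
    simp only [Finset.coe_filter, Set.mem_ofPred_eq] at hx hy
    have := (ZMod.natCast_eq_natCast_iff' x y m).1 hxy
    rwa [Nat.mod_eq_of_lt hx.2, Nat.mod_eq_of_lt hy.2] at this

lemma card_le_card_filter_lt_add_one (m : ℕ) (A : Finset ℕ) (hA : ∀ x ∈ A, x ≤ m) :
    A.card ≤ (A.filter (· < m)).card + 1 := by
  have : A ⊆ insert m (A.filter (· < m)) := by
    intro x hx
    rcases (hA x hx).eq_or_lt with h | h
    · exact Finset.mem_insert.2 (Or.inl h)
    · exact Finset.mem_insert.2 (Or.inr (Finset.mem_filter.2 ⟨hx, h⟩))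
  exact (Finset.card_le_card this).trans (Finset.card_insert_le _ _)

/-- A subgroup of `ZMod m` containing setwise coprime residues is everything. -/
lemma mem_of_gcd_eq_one (m : ℕ) (H : AddSubgroup (ZMod m)) (A : Finset ℕ) (hgcd : A.gcd id = 1)
    (hA : ∀ x ∈ A, (x : ZMod m) ∈ H) (g : ZMod m) : g ∈ H := by
  obtain ⟨d, hd⟩ := Int.subgroup_cyclic (H.comap (Int.castAddHom (ZMod m)))
  have hdvd : d.natAbs ∣ A.gcd id := by
    refine Finset.dvd_gcd fun x hx => ?_
    have hx' : (x : ℤ) ∈ H.comap (Int.castAddHom (ZMod m)) := by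
      simpa [AddSubgroup.mem_comap] using hA x hx
    rw [hd, ← AddSubgroup.zmultiples_eq_closure, Int.mem_zmultiples_iff] at hx'
    exact Int.natAbs_dvd_natAbs.2 hx'
  rw [hgcd, Nat.dvd_one] at hdvd
  obtain ⟨z, rfl⟩ := ZMod.intCast_surjective g
  have hz : z ∈ H.comap (Int.castAddHom (ZMod m)) := by
    rw [hd, ← AddSubgroup.zmultiples_eq_closure, Int.mem_zmultiples_iff, ← Int.natAbs_dvd, hdvd]
    simp
  simpa using hz

/-- The points of x + H missing from P are among the points of P + H missing from P. -/
lemma card_coset_sdiff_le {G : Type*} [AddCommGroup G] [DecidableEq G] [Finite G]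
    (H : AddSubgroup G) (P : Finset G) (x : G) (hx : x ∈ P) :
    Nat.card H + P.card ≤ (P ∩ cosetFinset H x).card + (P + cosetFinset H 0).card := by
  have hsub : P ∪ cosetFinset H x ⊆ P + cosetFinset H 0 := by
    refine Finset.union_subset (fun p hp => ?_) (fun y hy => ?_)
    · exact Finset.mem_add.2 ⟨p, hp, 0, by simp, add_zero p⟩
    · exact Finset.mem_add.2 ⟨x, hx, y - x, by simpa using hy, by simp⟩
  have h1 := Finset.card_le_card hsub
  have h2 := Finset.card_union_add_card_inter P (cosetFinset H x)
  rw [card_cosetFinset] at h2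
  omega

/-- The main step of the Lev-Smeliansky theorem: when the sumset is small, its reduction modulo
the largest element is everything. -/
lemma mem_add_image_cast (A B : Finset ℕ) (a : ℕ) (ha0 : 0 < a) (h0A : 0 ∈ A) (h0B : 0 ∈ B)
    (haA : a ∈ A) (hA : ∀ x ∈ A, x ≤ a) (hB : ∀ x ∈ B, x ≤ a) (hgcd : (A ∪ B).gcd id = 1)
    (hcard : (A + B).card + 4 ≤ A.card + B.card + min A.card B.card) (g : ZMod a) :
    g ∈ (A.image fun n : ℕ => (n : ZMod a)) + (B.image fun n : ℕ => (n : ZMod a)) := by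
  classical
  have : NeZero a := ⟨ha0.ne'⟩
  set P := A.image fun n : ℕ => (n : ZMod a) with hP
  set Q := B.image fun n : ℕ => (n : ZMod a) with hQ
  -- Only the element a can be lost in the reduction, as a ≡ 0.
  have hcP : A.card ≤ P.card + 1 :=
    (card_le_card_filter_lt_add_one a A hA).trans (by gcongr; exact card_le_card_image_cast a A)
  have hcQ : B.card ≤ Q.card + 1 :=
    (card_le_card_filter_lt_add_one a B hB).trans (by gcongr; exact card_le_card_image_cast a B)
  have h0P : (0 : ZMod a) ∈ P := Finset.mem_image.2 ⟨0, h0A, by simp⟩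
  have h0Q : (0 : ZMod a) ∈ Q := Finset.mem_image.2 ⟨0, h0B, by simp⟩
  have hlift : ∀ s ∈ P + Q, ∃ n ∈ A + B, (n : ZMod a) = s := by
    intro s hs
    obtain ⟨_, hp, _, hq, rfl⟩ := Finset.mem_add.1 hs
    obtain ⟨x, hx, rfl⟩ := Finset.mem_image.1 hp
    obtain ⟨y, hy, rfl⟩ := Finset.mem_image.1 hq
    exact ⟨x + y, Finset.add_mem_add hx hy, by push_cast; rfl⟩
  have hmin₁ := min_le_left A.card B.card
  have hmin₂ := min_le_right A.card B.card
  obtain ⟨H, hH, hK⟩ := kneser P Q ⟨0, h0P⟩ ⟨0, h0Q⟩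
  by_contra hg
  -- Case split: either some H-coset of P + Q misses Q, or every such coset meets Q.
  by_cases hc : ∃ x ∈ A, ∃ y ∈ B, ∀ z ∈ B, ((z : ZMod a) - ((x : ZMod a) + y)) ∉ H
  · obtain ⟨x, hx, y, hy, hxy⟩ := hc
    have hxP : (x : ZMod a) ∈ P := Finset.mem_image_of_mem _ hx
    have hyQ : (y : ZMod a) ∈ Q := Finset.mem_image_of_mem _ hy
    have hcount := card_add_card_le_card_filter a ha0 A B h0A haA
      ((P + Q) \ cosetFinset H (x + y)) (fun z hz => by
        rw [Finset.mem_sdiff, mem_cosetFinset]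
        exact ⟨by simpa using Finset.add_mem_add h0P (Finset.mem_image_of_mem _ hz), hxy z hz⟩)
      (fun s hs => hlift s (Finset.mem_sdiff.1 hs).1)
    set Ax := A.filter fun n : ℕ => (n : ZMod a) - x ∈ H with hAx
    set By := B.filter fun n : ℕ => (n : ZMod a) - y ∈ H with hBy
    have hcd := cauchy_davenport_add_of_linearOrder_isCancelAdd (s := Ax) (t := By)
      ⟨x, by simp [hAx, hx]⟩ ⟨y, by simp [hBy, hy]⟩
    have hdisj : Disjoint (Ax + By)
        ((A + B).filter fun n : ℕ => (n : ZMod a) ∈ (P + Q) \ cosetFinset H (x + y)) := by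
      rw [Finset.disjoint_left]
      intro z hz hz'
      obtain ⟨p, hp, q, hq, rfl⟩ := Finset.mem_add.1 hz
      have h1 := (Finset.mem_sdiff.1 (Finset.mem_filter.1 hz').2).2
      rw [mem_cosetFinset, Nat.cast_add, add_sub_add_comm] at h1
      exact h1 (H.add_mem (Finset.mem_filter.1 hp).2 (Finset.mem_filter.1 hq).2)
    have htot := Finset.card_le_card (Finset.union_subset
      (Finset.add_subset_add (Finset.filter_subset (fun n : ℕ => (n : ZMod a) - x ∈ H) A)
        (Finset.filter_subset (fun n : ℕ => (n : ZMod a) - y ∈ H) B))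
      (Finset.filter_subset (fun n : ℕ => (n : ZMod a) ∈ (P + Q) \ cosetFinset H (x + y)) (A + B)))
    rw [Finset.card_union_of_disjoint hdisj] at htot
    have hsd := Finset.le_card_sdiff (cosetFinset H ((x : ZMod a) + y)) (P + Q)
    rw [card_cosetFinset] at hsd
    have image_le : ∀ (C : Finset ℕ) (w : ZMod a),
        ((C.image fun n : ℕ => (n : ZMod a)) ∩ cosetFinset H w).card ≤
          (C.filter fun n : ℕ => (n : ZMod a) - w ∈ H).card := by
      intro C w
      refine le_trans (Finset.card_le_card ?_)
        (Finset.card_image_le (f := fun n : ℕ => (n : ZMod a)))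
      intro z hz
      rw [Finset.mem_inter, mem_cosetFinset] at hz
      obtain ⟨n, hn, rfl⟩ := Finset.mem_image.1 hz.1
      exact Finset.mem_image.2 ⟨n, Finset.mem_filter.2 ⟨hn, hz.2⟩, rfl⟩
    have i₁ : (P ∩ cosetFinset H (x : ZMod a)).card ≤ Ax.card := image_le A x
    have i₂ : (Q ∩ cosetFinset H (y : ZMod a)).card ≤ By.card := image_le B y
    have j₁ := card_coset_sdiff_le H P x hxP
    have j₂ := card_coset_sdiff_le H Q y hyQ
    have hAx1 : 1 ≤ Ax.card := Finset.card_pos.2 ⟨x, by simp [hAx, hx]⟩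
    -- Outside the coset there are at least |P+Q| - |H| + |B| sums, inside it at least |Ax| + |By| -
    -- 1. With `j₁`, `j₂` and Kneser the total is at least |P| + |Q| + |B| - 1 ≥ |A| + 2|B| - 3.
    omega
  · push Not at hc
    have hQH : Q + cosetFinset H 0 = P + Q := by
      ext z
      constructor
      · intro hz
        obtain ⟨q, hq, h, hh, rfl⟩ := Finset.mem_add.1 hz
        exact hH _ (by simpa using Finset.add_mem_add h0P hq) _ (by simpa using hh)
      · intro hz
        obtain ⟨_, hp, _, hq, rfl⟩ := Finset.mem_add.1 hz
        obtain ⟨x, hx, rfl⟩ := Finset.mem_image.1 hp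
        obtain ⟨y, hy, rfl⟩ := Finset.mem_image.1 hq
        obtain ⟨w, hw, hwH⟩ := hc x hx y hy
        exact Finset.mem_add.2 ⟨w, Finset.mem_image_of_mem _ hw, _,
          mem_cosetFinset.2 (by simpa using H.neg_mem hwH), add_sub_cancel _ _⟩
    -- With Q + H = P + Q, Kneser's inequality leaves only |P + H| ≤ |H|, so P lies in H.
    -- Coprimality then forces B to leave H, and |P+Q| ≥ 2|H| ≥ 2|A| - 2, too many for `hcard`.
    have hPle : (P + cosetFinset H 0).card ≤ Nat.card H := by rw [hQH] at hK; omega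
    have hcos : cosetFinset H 0 = P + cosetFinset H 0 := by
      refine Finset.eq_of_subset_of_card_le (fun h hh => ?_) (by rwa [card_cosetFinset])
      exact Finset.mem_add.2 ⟨0, h0P, h, hh, zero_add h⟩
    have hPH : ∀ p ∈ P, p ∈ H := by
      intro p hp
      have : p ∈ cosetFinset H 0 := by
        rw [hcos]; exact Finset.mem_add.2 ⟨p, hp, 0, by simp, add_zero p⟩
      simpa using this
    have hcPH : P.card ≤ Nat.card H := by
      rw [← card_cosetFinset H 0]
      exact Finset.card_le_card fun p hp => by simpa using hPH p hp
    obtain ⟨y, hy, hyH⟩ : ∃ y ∈ B, (y : ZMod a) ∉ H := by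
      by_contra! hBH
      refine hg ?_
      have := mem_of_gcd_eq_one a H (A ∪ B) hgcd (fun x hx => (Finset.mem_union.1 hx).elim
        (fun hx => hPH _ (Finset.mem_image_of_mem _ hx)) (hBH x)) g
      simpa using hH 0 (by simpa using Finset.add_mem_add h0P h0Q) g this
    have htwo : cosetFinset H 0 ∪ cosetFinset H (y : ZMod a) ⊆ P + Q := by
      rw [← hQH]
      refine Finset.union_subset (fun h hh => ?_) (fun h hh => ?_)
      · exact Finset.mem_add.2 ⟨0, h0Q, h, hh, zero_add h⟩
      · exact Finset.mem_add.2 ⟨y, Finset.mem_image_of_mem _ hy, h - y, by simpa using hh, by simp⟩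
    have hdisj : Disjoint (cosetFinset H 0) (cosetFinset H (y : ZMod a)) := by
      rw [Finset.disjoint_left]
      intro z hz hz'
      rw [mem_cosetFinset] at hz hz'
      exact hyH (by simpa using H.sub_mem hz hz')
    have h2 := Finset.card_le_card htwo
    rw [Finset.card_union_of_disjoint hdisj, card_cosetFinset, card_cosetFinset] at h2
    have hcount := card_add_card_le_card_filter a ha0 A B h0A haA (P + Q)
      (fun z hz => by simpa using Finset.add_mem_add h0P (Finset.mem_image_of_mem _ hz)) hlift
    have := Finset.card_filter_le (A + B) (fun n : ℕ => (n : ZMod a) ∈ P + Q)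
    omega

/-- Each of the m classes meets X + Y, so each one gains an element over Y. -/
lemma add_card_le_of_forall_mem_add_image_cast (X Y : Finset ℕ) (m : ℕ) (hm : 0 < m) (h0 : 0 ∈ X)
    (hmX : m ∈ X) (hfull : ∀ g : ZMod m,
      g ∈ (X.image fun n : ℕ => (n : ZMod m)) + (Y.image fun n : ℕ => (n : ZMod m))) :
    m + Y.card ≤ (X + Y).card := by
  have : NeZero m := ⟨hm.ne'⟩
  have := card_add_card_le_card_filter m hm X Y h0 hmX Finset.univ (fun _ _ => Finset.mem_univ _)
    (fun s _ => by
      obtain ⟨_, hp, _, hq, rfl⟩ := Finset.mem_add.1 (hfull s)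
      obtain ⟨x, hx, rfl⟩ := Finset.mem_image.1 hp
      obtain ⟨y, hy, rfl⟩ := Finset.mem_image.1 hq
      exact ⟨x + y, Finset.add_mem_add hx hy, by push_cast; rfl⟩)
  rw [Finset.card_univ, ZMod.card] at this
  exact this.trans (Finset.card_filter_le _ _)

/-- The **Lev-Smeliansky theorem**, with the set of larger diameter first. -/
lemma max_add_card_le_of_le (A B : Finset ℕ) (a b : ℕ) (hb0 : 0 < b) (hba : b ≤ a)
    (h0A : 0 ∈ A) (h0B : 0 ∈ B) (haA : a ∈ A) (hA : ∀ x ∈ A, x ≤ a) (hbB : b ∈ B)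
    (hB : ∀ x ∈ B, x ≤ b) (hgcd : (A ∪ B).gcd id = 1)
    (hcard : (A + B).card + 4 ≤ A.card + B.card + min A.card B.card) :
    a + B.card ≤ (A + B).card ∧ b + A.card ≤ (A + B).card := by
  have ha : a + B.card ≤ (A + B).card :=
    add_card_le_of_forall_mem_add_image_cast A B a (hb0.trans_le hba) h0A haA
      (mem_add_image_cast A B a (hb0.trans_le hba) h0A h0B haA hA (fun x hx => (hB x hx).trans hba)
        hgcd hcard)
  refine ⟨ha, ?_⟩
  have : NeZero b := ⟨hb0.ne'⟩
  rw [add_comm A B]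
  refine add_card_le_of_forall_mem_add_image_cast B A b hb0 h0B hbB fun g => ?_
  -- Modulo the smaller b pigeonhole suffices: A has at least |A| - (a + 1 - b) residues and B at
  -- least |B| - 1, and the bound on a just proved gives a + 4 ≤ |A| + |B|.
  refine mem_add_of_card_lt _ _ ?_ g
  rw [ZMod.card]
  have h1 := card_le_card_image_cast b A
  have h2 := card_le_card_image_cast b B
  have h3 := card_le_card_filter_lt_add_one b B hB
  have h4 : A.card ≤ (A.filter (· < b)).card + (a + 1 - b) := by
    rw [← Nat.card_Icc]
    refine le_trans (Finset.card_le_card fun x hx => ?_) (Finset.card_union_le _ _)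
    rw [Finset.mem_union, Finset.mem_filter, Finset.mem_Icc]
    have := hA x hx
    by_cases h : x < b
    · exact Or.inl ⟨hx, h⟩
    · exact Or.inr ⟨by omega, this⟩
  have hmin := min_le_right A.card B.card
  omega

/-- The **Lev-Smeliansky theorem**: two finite sets of naturals with small sumset are short. -/
theorem max_add_card_le (A B : Finset ℕ) (h0A : 0 ∈ A) (h0B : 0 ∈ B) (hA2 : 2 ≤ A.card)
    (hB2 : 2 ≤ B.card) (hgcd : (A ∪ B).gcd id = 1)
    (hcard : (A + B).card + 4 ≤ A.card + B.card + min A.card B.card) :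
    (∀ x ∈ A, x + B.card ≤ (A + B).card) ∧ (∀ y ∈ B, y + A.card ≤ (A + B).card) := by
  have key : ∀ C : Finset ℕ, 2 ≤ C.card → ∃ c ∈ C, 0 < c ∧ ∀ x ∈ C, x ≤ c := by
    intro C hC
    have hne : C.Nonempty := Finset.card_pos.1 (by omega)
    refine ⟨C.max' hne, C.max'_mem hne, ?_, C.le_max'⟩
    obtain ⟨x, hx, hx0⟩ := Finset.exists_mem_ne hC 0
    exact (Nat.pos_of_ne_zero hx0).trans_le (C.le_max' x hx)
  obtain ⟨a, haA, ha0, ha⟩ := key A hA2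
  obtain ⟨b, hbB, hb0, hb⟩ := key B hB2
  obtain ⟨h1, h2⟩ : a + B.card ≤ (A + B).card ∧ b + A.card ≤ (A + B).card := by
    rcases le_total b a with h | h
    · exact max_add_card_le_of_le A B a b hb0 h h0A h0B haA ha hbB hb hgcd hcard
    · have := max_add_card_le_of_le B A b a ha0 h h0B h0A hbB hb haA ha
        (by rwa [Finset.union_comm]) (by rw [add_comm B A, min_comm]; omega)
      rw [add_comm B A] at this
      exact this.symm
  exact ⟨fun x hx => (Nat.add_le_add_right (ha x hx) _).trans h1,
    fun y hy => (Nat.add_le_add_right (hb y hy) _).trans h2⟩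

end SumsetsOfNaturals

/-! ### Normalization of degree tables -/

namespace ExponentVectors

variable {K L T : ℕ}

lemma image_append {m n : ℕ} (f : Fin m → ℕ) (g : Fin n → ℕ) :
    Finset.univ.image (Fin.append f g) = Finset.univ.image f ∪ Finset.univ.image g := by
  ext x
  simp only [Finset.mem_image, Finset.mem_univ, true_and, Finset.mem_union]
  constructor
  · rintro ⟨i, rfl⟩
    refine Fin.addCases (fun i => Or.inl ⟨i, by simp⟩) (fun i => Or.inr ⟨i, by simp⟩) i
  · rintro (⟨i, rfl⟩ | ⟨i, rfl⟩)
    · exact ⟨Fin.castAdd n i, by simp⟩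
    · exact ⟨Fin.natAdd m i, by simp⟩

lemma alphaSet_eq (D : ExponentVectors K L T) :
    D.alphaSet = D.alphaPSet ∪ Finset.univ.image D.alphaS := image_append _ _

lemma betaSet_eq (D : ExponentVectors K L T) :
    D.betaSet = D.betaPSet ∪ Finset.univ.image D.betaS := image_append _ _

lemma alpha_mem (D : ExponentVectors K L T) (i : Fin (K + T)) : D.alpha i ∈ D.alphaSet :=
  Finset.mem_image_of_mem _ (Finset.mem_univ i)

lemma beta_mem (D : ExponentVectors K L T) (j : Fin (L + T)) : D.beta j ∈ D.betaSet :=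
  Finset.mem_image_of_mem _ (Finset.mem_univ j)

lemma IsDegreeTable.card_alphaSet {D : ExponentVectors K L T} (hD : D.IsDegreeTable) :
    D.alphaSet.card = K + T := by
  rw [alphaSet, Finset.card_image_of_injective _ hD.alpha_injective, Finset.card_univ,
    Fintype.card_fin]

lemma IsDegreeTable.card_betaSet {D : ExponentVectors K L T} (hD : D.IsDegreeTable) :
    D.betaSet.card = L + T := by
  rw [betaSet, Finset.card_image_of_injective _ hD.beta_injective, Finset.card_univ,
    Fintype.card_fin]

lemma injective_of_card_image {n : ℕ} (f : Fin n → ℕ) (h : n ≤ (Finset.univ.image f).card) :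
    Function.Injective f := by
  rw [← Set.injOn_univ, ← Finset.coe_univ, ← Finset.card_image_iff]
  exact le_antisymm Finset.card_image_le (by simpa using h)

/-- A quadruple of finite sets of the right sizes comes from a quadruple of increasing vectors. -/
lemma exists_sorted (P S Q R : Finset ℕ) (hP : P.card = K) (hS : S.card = T) (hQ : Q.card = L)
    (hR : R.card = T) :
    ∃ D : ExponentVectors K L T, D.alphaPSet = P ∧ D.betaPSet = Q ∧ D.alphaSet = P ∪ S ∧
      D.betaSet = Q ∪ R ∧ StrictMono D.alphaP ∧ StrictMono D.alphaS ∧ StrictMono D.betaP ∧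
      StrictMono D.betaS := by
  have him : ∀ {n : ℕ} (C : Finset ℕ) (h : C.card = n),
      Finset.univ.image (C.orderEmbOfFin h) = C := fun C h => by
    rw [← Finset.coe_inj]; simp
  refine ⟨⟨P.orderEmbOfFin hP, S.orderEmbOfFin hS, Q.orderEmbOfFin hQ, R.orderEmbOfFin hR⟩,
    him P hP, him Q hQ, ?_, ?_, OrderEmbedding.strictMono _, OrderEmbedding.strictMono _,
    OrderEmbedding.strictMono _, OrderEmbedding.strictMono _⟩
  · rw [alphaSet_eq, alphaPSet, him, him]
  · rw [betaSet_eq, betaPSet, him, him]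

/-- Every degree table can be normalized without changing the number of terms. -/
theorem IsDegreeTable.exists_isNormal {D : ExponentVectors K L T} (hD : D.IsDegreeTable)
    (hK : 0 < K) (hL : 0 < L) (hT : 0 < T) :
    ∃ D' : ExponentVectors K L T, D'.IsDegreeTable ∧ D'.IsNormal ∧ D'.numTerms = D.numTerms := by
  have hcA := hD.card_alphaSet
  have hcB := hD.card_betaSet
  have hneA : D.alphaSet.Nonempty := Finset.card_pos.1 (by omega)
  have hneB : D.betaSet.Nonempty := Finset.card_pos.1 (by omega)
  set a := D.alphaSet.min' hneA with ha
  set b := D.betaSet.min' hneB with hb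
  have haA : a ∈ D.alphaSet := D.alphaSet.min'_mem hneA
  have hbB : b ∈ D.betaSet := D.betaSet.min'_mem hneB
  have hle_a : ∀ x ∈ D.alphaSet, a ≤ x := fun x hx => D.alphaSet.min'_le x hx
  have hle_b : ∀ x ∈ D.betaSet, b ≤ x := fun x hx => D.betaSet.min'_le x hx
  set U := D.alphaSet.image (· - a) ∪ D.betaSet.image (· - b) with hU
  set g := U.gcd id with hg
  -- A second entry of α, available since K + T ≥ 2, makes the gcd of the shifted entries nonzero.
  obtain ⟨u, huA, hua⟩ := Finset.exists_mem_ne (show 1 < D.alphaSet.card by omega) a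
  have huU : u - a ∈ U := Finset.mem_union_left _ (Finset.mem_image_of_mem (· - a) huA)
  have hu0 : u - a ≠ 0 := by have := hle_a u huA; omega
  have hg0 : 0 < g := Nat.pos_of_ne_zero fun h => hu0 (Finset.gcd_eq_zero_iff.1 h _ huU)
  set f : ℕ → ℕ := fun x => (x - a) / g with hf
  set k : ℕ → ℕ := fun x => (x - b) / g with hk
  have hfx : ∀ x ∈ D.alphaSet, g * f x + a = x := fun x hx => by
    have hd : g ∣ x - a :=
      Finset.gcd_dvd (f := id) (Finset.mem_union_left _ (Finset.mem_image_of_mem (· - a) hx))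
    rw [hf, Nat.mul_div_cancel' hd, Nat.sub_add_cancel (hle_a x hx)]
  have hkx : ∀ x ∈ D.betaSet, g * k x + b = x := fun x hx => by
    have hd : g ∣ x - b :=
      Finset.gcd_dvd (f := id) (Finset.mem_union_right _ (Finset.mem_image_of_mem (· - b) hx))
    rw [hk, Nat.mul_div_cancel' hd, Nat.sub_add_cancel (hle_b x hx)]
  have hfinj : Set.InjOn f D.alphaSet := fun x hx y hy h => by
    rw [← hfx x hx, ← hfx y hy, h]
  have hkinj : Set.InjOn k D.betaSet := fun x hx y hy h => by
    rw [← hkx x hx, ← hkx y hy, h]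
  have hcard : ∀ {n : ℕ} (v : Fin n → ℕ), Function.Injective v → (Finset.univ.image v).card = n :=
    fun v hv => by rw [Finset.card_image_of_injective _ hv, Finset.card_univ, Fintype.card_fin]
  have iαP : Function.Injective D.alphaP := fun i j h => by
    have := @hD.alpha_injective (Fin.castAdd T i) (Fin.castAdd T j) (by simpa [alpha] using h)
    simpa using this
  have iαS : Function.Injective D.alphaS := fun i j h => by
    have := @hD.alpha_injective (Fin.natAdd K i) (Fin.natAdd K j) (by simpa [alpha] using h)
    simpa using this
  have iβP : Function.Injective D.betaP := fun i j h => by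
    have := @hD.beta_injective (Fin.castAdd T i) (Fin.castAdd T j) (by simpa [beta] using h)
    simpa using this
  have iβS : Function.Injective D.betaS := fun i j h => by
    have := @hD.beta_injective (Fin.natAdd L i) (Fin.natAdd L j) (by simpa [beta] using h)
    simpa using this
  have sαP : D.alphaPSet ⊆ D.alphaSet := by rw [alphaSet_eq]; exact Finset.subset_union_left
  have sβP : D.betaPSet ⊆ D.betaSet := by rw [betaSet_eq]; exact Finset.subset_union_left
  have sαS : Finset.univ.image D.alphaS ⊆ D.alphaSet := by
    rw [alphaSet_eq]; exact Finset.subset_union_right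
  have sβS : Finset.univ.image D.betaS ⊆ D.betaSet := by
    rw [betaSet_eq]; exact Finset.subset_union_right
  obtain ⟨D', hP, hQ, hA, hB, m₁, m₂, m₃, m₄⟩ := exists_sorted (K := K) (L := L) (T := T)
    (D.alphaPSet.image f) ((Finset.univ.image D.alphaS).image f)
    (D.betaPSet.image k) ((Finset.univ.image D.betaS).image k)
    ((Finset.card_image_of_injOn (hfinj.mono (by exact_mod_cast sαP))).trans (hcard _ iαP))
    ((Finset.card_image_of_injOn (hfinj.mono (by exact_mod_cast sαS))).trans (hcard _ iαS))
    ((Finset.card_image_of_injOn (hkinj.mono (by exact_mod_cast sβP))).trans (hcard _ iβP))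
    ((Finset.card_image_of_injOn (hkinj.mono (by exact_mod_cast sβS))).trans (hcard _ iβS))
  rw [← Finset.image_union, ← alphaSet_eq] at hA
  rw [← Finset.image_union, ← betaSet_eq] at hB
  refine ⟨D', ⟨?_, ?_, ?_⟩, ⟨m₁, m₂, m₃, m₄, ?_, ?_, ?_⟩, ?_⟩
  · refine injective_of_card_image _ ?_
    change _ ≤ D'.alphaSet.card
    rw [hA, Finset.card_image_of_injOn hfinj, hcA]
  · refine injective_of_card_image _ ?_
    change _ ≤ D'.betaSet.card
    rw [hB, Finset.card_image_of_injOn hkinj, hcB]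
  · rw [hP, hQ, hA, hB]
    intro n hn
    obtain ⟨_, hp', _, hq', rfl⟩ := Finset.mem_add.1 hn
    obtain ⟨p, hp, rfl⟩ := Finset.mem_image.1 hp'
    obtain ⟨q, hq, rfl⟩ := Finset.mem_image.1 hq'
    refine ⟨(f p, k q), ⟨Finset.mem_image_of_mem _ (sαP hp), Finset.mem_image_of_mem _ (sβP hq),
      rfl⟩, ?_⟩
    rintro ⟨x', y'⟩ ⟨hx', hy', hxy⟩
    obtain ⟨x, hx, rfl⟩ := Finset.mem_image.1 hx'
    obtain ⟨y, hy, rfl⟩ := Finset.mem_image.1 hy'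
    have hsum : p + q = x + y := by
      rw [← hfx p (sαP hp), ← hkx q (sβP hq), ← hfx x hx, ← hkx y hy]
      have := congrArg (g * ·) hxy
      simp only [mul_add] at this
      omega
    have := (hD.decodable _ (Finset.add_mem_add hp hq)).unique
      (y₁ := (x, y)) (y₂ := (p, q)) ⟨hx, hy, hsum⟩ ⟨sαP hp, sβP hq, rfl⟩
    rw [Prod.mk.injEq] at this
    rw [this.1, this.2]
  · rw [hA]
    exact ⟨by simpa using ⟨a, haA, by simp [hf]⟩, fun _ _ => Nat.zero_le _⟩
  · rw [hB]
    exact ⟨by simpa using ⟨b, hbB, by simp [hk]⟩, fun _ _ => Nat.zero_le _⟩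
  · have : D'.alphaSet ∪ D'.betaSet = U.image (· / g) := by
      rw [hA, hB, hU, Finset.image_union, Finset.image_image, Finset.image_image]
      rfl
    rw [this, Finset.gcd_image]
    exact Finset.gcd_div_id_eq_one huU hu0
  · rw [numTerms, numTerms, hA, hB]
    -- The old sumset is the image of the new one under the injection z ↦ g z + (a + b).
    rw [← Finset.card_image_of_injective (D.alphaSet.image f + D.betaSet.image k)
      (f := fun z => g * z + (a + b))
      (fun x y h => Nat.eq_of_mul_eq_mul_left hg0 (Nat.add_right_cancel h))]
    congr 1
    ext z
    constructor
    · intro hz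
      obtain ⟨w, hw, rfl⟩ := Finset.mem_image.1 hz
      obtain ⟨_, hx', _, hy', rfl⟩ := Finset.mem_add.1 hw
      obtain ⟨x, hx, rfl⟩ := Finset.mem_image.1 hx'
      obtain ⟨y, hy, rfl⟩ := Finset.mem_image.1 hy'
      refine Finset.mem_add.2 ⟨x, hx, y, hy, ?_⟩
      have h1 := hfx x hx
      have h2 := hkx y hy
      rw [mul_add]
      omega
    · intro hz
      obtain ⟨x, hx, y, hy, rfl⟩ := Finset.mem_add.1 hz
      refine Finset.mem_image.2 ⟨f x + k y, Finset.add_mem_add (Finset.mem_image_of_mem _ hx)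
        (Finset.mem_image_of_mem _ hy), ?_⟩
      have h1 := hfx x hx
      have h2 := hkx y hy
      rw [mul_add]
      omega

/-! ### An explicit table with at most 2KL + 2T - 1 terms -/

/-- The degree table `α = (0, …, K - 1 | KL, …, KL + T - 1)`,
`β = (0, K, …, K (L - 1) | KL, …, KL + T - 1)`. -/
def gaspBig (K L T : ℕ) : ExponentVectors K L T where
  alphaP i := i
  alphaS t := K * L + t
  betaP j := K * j
  betaS t := K * L + t

lemma mem_alphaSet_gaspBig {x : ℕ} (hx : x ∈ (gaspBig K L T).alphaSet) :
    x < K ∨ (K * L ≤ x ∧ x < K * L + T) := by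
  rw [alphaSet_eq, Finset.mem_union] at hx
  rcases hx with hx | hx
  · obtain ⟨i, -, rfl⟩ := Finset.mem_image.1 hx
    exact Or.inl i.2
  · obtain ⟨t, -, rfl⟩ := Finset.mem_image.1 hx
    exact Or.inr ⟨Nat.le_add_right _ _, Nat.add_lt_add_left t.2 _⟩

lemma mem_betaSet_gaspBig {x : ℕ} (hx : x ∈ (gaspBig K L T).betaSet) :
    (∃ j < L, x = K * j) ∨ (K * L ≤ x ∧ x < K * L + T) := by
  rw [betaSet_eq, Finset.mem_union] at hx
  rcases hx with hx | hx
  · obtain ⟨j, -, rfl⟩ := Finset.mem_image.1 hx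
    exact Or.inl ⟨j, j.2, rfl⟩
  · obtain ⟨t, -, rfl⟩ := Finset.mem_image.1 hx
    exact Or.inr ⟨Nat.le_add_right _ _, Nat.add_lt_add_left t.2 _⟩

/-- Prefix sums i + K j lie below KL, so no suffix entry can take part, and i and j are the
remainder and quotient modulo K. -/
lemma isDegreeTable_gaspBig (hK : 0 < K) (hL : 0 < L) : (gaspBig K L T).IsDegreeTable := by
  have hKL : K ≤ K * L := Nat.le_mul_of_pos_right K hL
  refine ⟨?_, ?_, ?_⟩
  · refine Fin.append_injective_iff.2 ⟨Fin.val_injective,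
      fun i j h => Fin.ext (Nat.add_left_cancel h), fun i j h => ?_⟩
    have h1 := i.2
    simp only [gaspBig] at h
    omega
  · refine Fin.append_injective_iff.2 ⟨fun i j h => Fin.ext (Nat.eq_of_mul_eq_mul_left hK h),
      fun i j h => Fin.ext (Nat.add_left_cancel h), fun i j h => ?_⟩
    have h1 := Nat.mul_lt_mul_of_pos_left i.2 hK
    simp only [gaspBig] at h
    omega
  · intro n hn
    obtain ⟨p, hp, q, hq, rfl⟩ := Finset.mem_add.1 hn
    have hpA : p ∈ (gaspBig K L T).alphaSet := by
      rw [alphaSet_eq]; exact Finset.mem_union_left _ hp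
    have hqB : q ∈ (gaspBig K L T).betaSet := by
      rw [betaSet_eq]; exact Finset.mem_union_left _ hq
    refine ⟨(p, q), ⟨hpA, hqB, rfl⟩, ?_⟩
    rintro ⟨x, y⟩ ⟨hx, hy, hxy⟩
    obtain ⟨i, -, rfl⟩ := Finset.mem_image.1 hp
    obtain ⟨j, -, rfl⟩ := Finset.mem_image.1 hq
    simp only [gaspBig] at hxy ⊢
    have hi := i.2
    have hj : K * (j : ℕ) + K ≤ K * L := by
      rw [← Nat.mul_succ]; exact Nat.mul_le_mul_left K j.2
    have hx' : x < K := by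
      rcases mem_alphaSet_gaspBig hx with h | h <;> omega
    obtain ⟨l, -, rfl⟩ : ∃ l < L, y = K * l := by
      rcases mem_betaSet_gaspBig hy with h | h
      · exact h
      · omega
    have hmod := congrArg (· % K) hxy
    simp only [Nat.add_mul_mod_self_left, Nat.mod_eq_of_lt hi, Nat.mod_eq_of_lt hx'] at hmod
    rw [Prod.mk.injEq]
    omega

lemma numTerms_gaspBig_lt (hK : 0 < K) (hL : 0 < L) (hT : 0 < T) :
    (gaspBig K L T).numTerms + 1 ≤ 2 * (K * L) + 2 * T := by
  have hKL : K ≤ K * L := Nat.le_mul_of_pos_right K hL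
  have hsub : (gaspBig K L T).alphaSet + (gaspBig K L T).betaSet ⊆
      Finset.range (2 * (K * L) + 2 * T - 1) := by
    intro z hz
    obtain ⟨x, hx, y, hy, rfl⟩ := Finset.mem_add.1 hz
    have h1 : x < K * L + T := by rcases mem_alphaSet_gaspBig hx with h | h <;> omega
    have h2 : y < K * L + T := by
      rcases mem_betaSet_gaspBig hy with ⟨j, hj, rfl⟩ | h
      · have := Nat.mul_lt_mul_of_pos_left hj hK
        omega
      · omega
    rw [Finset.mem_range]
    omega
  have := Finset.card_le_card hsub
  rw [Finset.card_range] at this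
  rw [numTerms]
  omega

end ExponentVectors

/-! ### Reduction to a finite search -/

open ExponentVectors in
lemma minNumTerms_lt (K L T : ℕ) (hK : 0 < K) (hL : 0 < L) (hT : 0 < T) :
    minNumTerms K L T + 1 ≤ 2 * (K * L) + 2 * T :=
  (Nat.add_le_add_right (Nat.sInf_le (Set.mem_image_of_mem numTerms
    (show gaspBig K L T ∈ degreeTables K L T from isDegreeTable_gaspBig hK hL))) 1).trans
    (numTerms_gaspBig_lt hK hL hT)

lemma finite_boundedNormalTables (K L T : ℕ) (a b : ℤ) :
    (boundedNormalTables K L T a b).Finite := by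
  refine Set.Finite.of_injOn
    (f := fun D : ExponentVectors K L T => (D.alpha, D.beta))
    (t := Set.Icc 0 (fun _ => a.toNat) ×ˢ Set.Icc 0 (fun _ => b.toNat)) ?_ ?_
    ((Set.finite_Icc _ _).prod (Set.finite_Icc _ _))
  · rintro D ⟨-, -, h1, h2⟩
    refine ⟨⟨fun i => Nat.zero_le _, fun i => ?_⟩, ⟨fun j => Nat.zero_le _, fun j => ?_⟩⟩
    · have := h1 i
      change D.alpha i ≤ a.toNat
      omega
    · have := h2 j
      change D.beta j ≤ b.toNat
      omega
  · intro D _ E _ h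
    rw [Prod.mk.injEq] at h
    ext i
    · simpa [ExponentVectors.alpha] using congrFun h.1 (Fin.castAdd T i)
    · simpa [ExponentVectors.alpha] using congrFun h.1 (Fin.natAdd K i)
    · simpa [ExponentVectors.beta] using congrFun h.2 (Fin.castAdd T i)
    · simpa [ExponentVectors.beta] using congrFun h.2 (Fin.natAdd L i)

theorem theorem6 (K L T : ℕ) (hK : 0 < K) (hL : 0 < L) (hT : 0 < T)
    (h : 2 * (K : ℤ) * L - K - L - min (K : ℤ) L + 3 ≤ T) :
    (∀ D ∈ degreeTables K L T, D.IsNormal → D.numTerms = minNumTerms K L T →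
      (∀ i, (D.alpha i : ℤ) ≤ 2 * K * L + T - 1 - L) ∧
      (∀ j, (D.beta j : ℤ) ≤ 2 * K * L + T - 1 - K)) ∧
    (boundedNormalTables K L T (2 * K * L + T - 1 - L) (2 * K * L + T - 1 - K)).Finite ∧
    IsLeast (ExponentVectors.numTerms ''
      boundedNormalTables K L T (2 * K * L + T - 1 - L) (2 * K * L + T - 1 - K))
      (minNumTerms K L T) := by
  have hbound : ∀ D ∈ degreeTables K L T, D.IsNormal → D.numTerms = minNumTerms K L T →
      (∀ i, (D.alpha i : ℤ) ≤ 2 * K * L + T - 1 - L) ∧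
      (∀ j, (D.beta j : ℤ) ≤ 2 * K * L + T - 1 - K) := by
    intro D hD hn hmin
    have hN := minNumTerms_lt K L T hK hL hT
    rw [← hmin, ExponentVectors.numTerms] at hN
    have hcA := ExponentVectors.IsDegreeTable.card_alphaSet hD
    have hcB := ExponentVectors.IsDegreeTable.card_betaSet hD
    have hmul : (2 : ℤ) * K * L = 2 * ((K * L : ℕ) : ℤ) := by push_cast; ring
    rw [hmul] at h ⊢
    obtain ⟨h1, h2⟩ := max_add_card_le D.alphaSet D.betaSet (by simpa using hn.alpha_min.1)
      (by simpa using hn.beta_min.1) (by omega) (by omega) hn.gcd_eq_one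
      -- This is the hypothesis on T, rearranged using |A+B| ≤ 2KL + 2T - 1.
      (by rw [hcA, hcB]; omega)
    refine ⟨fun i => ?_, fun j => ?_⟩
    · have := h1 _ (D.alpha_mem i)
      omega
    · have := h2 _ (D.beta_mem j)
      omega
  refine ⟨hbound, finite_boundedNormalTables _ _ _ _ _, ?_, ?_⟩
  -- `gaspBig` shows that the set is nonempty, so the infimum is attained rather than the default 0.
  · obtain ⟨D, hD, hmin⟩ := Nat.sInf_mem (s := ExponentVectors.numTerms '' degreeTables K L T)
      ⟨_, _, ExponentVectors.isDegreeTable_gaspBig hK hL, rfl⟩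
    obtain ⟨D', hD', hn, hnum⟩ :=
      ExponentVectors.IsDegreeTable.exists_isNormal (D := D) hD hK hL hT
    have heq : D'.numTerms = minNumTerms K L T := hnum.trans hmin
    exact ⟨D', ⟨hD', hn, hbound D' hD' hn heq⟩, heq⟩
  · rintro _ ⟨D, hD, rfl⟩
    exact Nat.sInf_le ⟨D, hD.1, rfl⟩
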